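/- Let $\Gamma$ be a finite simple graph and let $R(\Gamma)$ be its right-angled Artin group, i.e. the group generated by the vertices of $\Gamma$ subject to the relations $vw=wv$ for all pairs of adjacent vertices $v,w$. For a group $G$ let $m(G)\in\{1,2,\dots\}\cup\{\infty\}$ be the least $d\ge 1$ such that $G$ embeds in $GL(d,\mathbb F)$ for some field $\mathbb F$, and for $p$ equal to $0$ or a prime let $m_p(G)$ be the least $d\ge 1$ such that $G$ embeds in $GL(d,\mathbb F)$ for some field $\mathbb F$ of characteristic $p$ (in both cases $\infty$ if there is no such $d$). Let $\Gamma'$ be the induced subgraph of $\Gamma$ obtained by deleting every vertex that is adjacent to all other vertices of $\Gamma$. Then the following are equivalent: (i) $m(R(\Gamma))=2$; (ii) $m_p(R(\Gamma))=2$ for every $p$ that is $0$ or a prime; (iii) $\Gamma'$ has at least two connected components, and each connected component of $\Gamma'$ is a complete graph. Moreover, for each single $p$ that is $0$ or a prime, $m_p(R(\Gamma))=2$ if and only if (iii) holds. -/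

import Mathlib

universe w u

/-- The group `G` has a faithful representation of dimension `d` over the field `F`,
that is, an injective homomorphism into `GL(d, F)`. -/
def HasFaithfulRep (G : Type*) [Group G] (F : Type*) [Field F] (d : ℕ) : Prop :=
  ∃ ρ : G →* Matrix.GeneralLinearGroup (Fin d) F, Function.Injective ρ

/-- `m(G)`: the least positive integer `d` such that `G` has a faithful representation of
dimension `d` over some field (of any characteristic), and `⊤` if there is no such `d`.
The fields range over the universe `w`. -/
noncomputable def minDim (G : Type u) [Group G] : ℕ∞ :=
  sInf {x : ℕ∞ | ∃ d : ℕ, x = (d : ℕ∞) ∧ 1 ≤ d ∧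
    ∃ (F : Type w) (_ : Field F), HasFaithfulRep G F d}

/-- `m_p(G)`: the least positive integer `d` such that `G` has a faithful representation of
dimension `d` over some field of characteristic `p`, and `⊤` if there is no such `d`.
The fields range over the universe `w`. -/
noncomputable def minDimChar (p : ℕ) (G : Type u) [Group G] : ℕ∞ :=
  sInf {x : ℕ∞ | ∃ d : ℕ, x = (d : ℕ∞) ∧ 1 ≤ d ∧
    ∃ (F : Type w) (_ : Field F) (_ : CharP F p), HasFaithfulRep G F d}

/-- The defining relators of the right-angled Artin group: one commutator for each pair of
adjacent vertices. -/
def raagRels {V : Type*} (Γ : SimpleGraph V) : Set (FreeGroup V) :=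
  {r | ∃ v w : V, Γ.Adj v w ∧
    r = FreeGroup.of v * FreeGroup.of w * (FreeGroup.of v)⁻¹ * (FreeGroup.of w)⁻¹}

/-- The right-angled Artin group `R(Γ)`: generated by the vertices of `Γ`, where adjacent
vertices commute. -/
abbrev RAAG {V : Type*} (Γ : SimpleGraph V) : Type _ :=
  PresentedGroup (raagRels Γ)

/-- The graph that remains after all vertices adjacent to every other vertex are deleted
(together with their incident edges). -/
abbrev deleteUniversal {V : Type*} (Γ : SimpleGraph V) :
    SimpleGraph ↥(Γ.universalVertsᶜ) :=
  Γ.induce Γ.universalVertsᶜ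

/-- The graph `H` has at least two connected components, and any two distinct vertices of the
same component are adjacent. -/
def TwoOrMoreCompleteComponents {W : Type*} (H : SimpleGraph W) : Prop :=
  2 ≤ ENat.card H.ConnectedComponent ∧ ∀ c : H.ConnectedComponent, H.IsClique c.supp

/-! Sufficiency: take a field `K` with multiplicatively independent units `t v`. A universal vertex
goes to the scalar `t v`; a vertex of another component goes to the element with eigenvalues `t v`
and its inverse in a torus of `GL (Fin 2) K[X]` depending only on the component. Ping-pong
(`torus_lift_injective`) shows that these tori generate their free product. Torus elements have
determinant 1, so the determinant separates off the scalars. Hence the product of a free abelian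
group and a free product of free abelian groups, which surjects onto `R(Γ)`, embeds in `GL₂`, and so
does `R(Γ)`.

Necessity: a nonscalar 2 × 2 matrix has a commutative centralizer. So if `a - b - c` is a path with
`a`, `c` distinct and nonadjacent, then `b` is central in `R(Γ)`, which forces `b` to be universal.
Adjacency is therefore transitive on distinct vertices of `Γ'`. Complete graphs are excluded because
their groups embed in `GL₁`. -/

namespace RAAG

/-! ### Right-angled Artin groups and their universal property -/

variable {V : Type*} {Γ : SimpleGraph V} {G : Type*} [Group G]

/-- The generator of `R(Γ)` given by a vertex. -/
abbrev gen (Γ : SimpleGraph V) (v : V) : RAAG Γ := PresentedGroup.of v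

theorem gen_commute {v w : V} (h : Γ.Adj v w) : Commute (gen Γ v) (gen Γ w) := by
  have h1 : PresentedGroup.mk (raagRels Γ)
      (FreeGroup.of v * FreeGroup.of w * (FreeGroup.of v)⁻¹ * (FreeGroup.of w)⁻¹) = 1 :=
    PresentedGroup.one_of_mem ⟨v, w, h, rfl⟩
  simp only [map_mul, map_inv] at h1
  rw [mul_inv_eq_one, mul_inv_eq_iff_eq_mul] at h1
  exact h1

/-- The universal property of `R(Γ)`. -/
def lift (f : V → G) (hf : ∀ v w, Γ.Adj v w → Commute (f v) (f w)) : RAAG Γ →* G :=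
  PresentedGroup.toGroup (f := f) (by
    rintro r ⟨v, w, h, rfl⟩
    simp only [map_mul, map_inv, FreeGroup.lift_apply_of]
    rw [mul_inv_eq_one, mul_inv_eq_iff_eq_mul]
    exact hf v w h)

@[simp]
theorem lift_gen (f : V → G) (hf : ∀ v w, Γ.Adj v w → Commute (f v) (f w)) (v : V) :
    lift f hf (gen Γ v) = f v :=
  PresentedGroup.toGroup.of _

theorem closure_range_gen : Subgroup.closure (Set.range (gen Γ)) = ⊤ :=
  PresentedGroup.closure_range_of _

/-- An element that commutes with the images of the generators commutes with the whole image. -/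
theorem commute_of_gen (f : RAAG Γ →* G) (g : G) (h : ∀ v, Commute (f (gen Γ v)) g) (x : RAAG Γ) :
    Commute (f x) g := by
  have : (⊤ : Subgroup (RAAG Γ)) ≤ (Subgroup.centralizer {g}).comap f := by
    rw [← closure_range_gen, Subgroup.closure_le]
    rintro _ ⟨v, rfl⟩
    simp only [Subgroup.coe_comap, Set.mem_preimage, SetLike.mem_coe,
      Subgroup.mem_centralizer_singleton_iff]
    exact h v
  have h2 := this (Subgroup.mem_top x)
  rwa [Subgroup.mem_comap, Subgroup.mem_centralizer_singleton_iff] at h2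

/-- Distinct nonadjacent vertices do not commute in `R(Γ)`. -/
theorem not_commute_gen {v w : V} (hne : v ≠ w) (h : ¬ Γ.Adj v w) :
    ¬ Commute (gen Γ v) (gen Γ w) := by
  classical
  -- All other vertices are killed; the two given ones become noncommuting transpositions.
  let f : V → Equiv.Perm (Fin 3) := fun x =>
    if x = v then Equiv.swap 0 1 else if x = w then Equiv.swap 1 2 else 1
  have hf : ∀ x y, Γ.Adj x y → Commute (f x) (f y) := by
    intro x y hxy
    have hxy' := hxy.ne
    by_cases hx : x = v
    · have hy : f y = 1 := by
        have h1 : y ≠ v := by rintro rfl; exact hxy' hx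
        have h2 : y ≠ w := by rintro rfl; subst hx; exact h hxy
        simp [f, h1, h2]
      rw [hy]; exact Commute.one_right _
    · by_cases hx2 : x = w
      · have hy : f y = 1 := by
          have h1 : y ≠ w := by rintro rfl; exact hxy' hx2
          have h2 : y ≠ v := by rintro rfl; subst hx2; exact h hxy.symm
          simp [f, h1, h2]
        rw [hy]; exact Commute.one_right _
      · have : f x = 1 := by simp [f, hx, hx2]
        rw [this]; exact Commute.one_left _
  intro hc
  have h2 := hc.map (lift f hf)
  rw [lift_gen, lift_gen] at h2
  have e1 : f v = Equiv.swap 0 1 := by simp [f]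
  have e2 : f w = Equiv.swap 1 2 := by simp [f, hne.symm]
  rw [e1, e2] at h2
  revert h2
  unfold Commute SemiconjBy
  decide

instance commGroupTop : CommGroup (RAAG (⊤ : SimpleGraph V)) where
  mul_comm a b := by
    refine commute_of_gen (MonoidHom.id _) b (fun v => ?_) a
    refine (commute_of_gen (MonoidHom.id _) _ (fun w => ?_) b).symm
    by_cases h : w = v
    · subst h; exact Commute.refl _
    · exact gen_commute (by simpa using h)

/-! ### Free abelian groups and multiplicatively independent units -/

/-- The elements `t v` of a commutative group satisfy no nontrivial multiplicative relation. -/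
def MulIndep {A : Type*} [CommGroup A] (t : V → A) : Prop :=
  ∀ z : V →₀ ℤ, (z.prod fun v n => t v ^ n) = 1 → z = 0

section MulIndep
variable {A : Type*} [CommGroup A] {t : V → A}

theorem MulIndep.comp (ht : MulIndep t) {W : Type*} {f : W → V} (hf : Function.Injective f) :
    MulIndep (t ∘ f) := by
  intro z hz
  have := ht (z.embDomain ⟨f, hf⟩) (by rw [Finsupp.prod_embDomain]; exact hz)
  simpa using this

theorem MulIndep.pow_eq_one (ht : MulIndep t) {v : V} {n : ℤ} (h : t v ^ n = 1) : n = 0 := by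
  have := ht (Finsupp.single v n) (by simpa using h)
  simpa using this

theorem MulIndep.injective (ht : MulIndep t) : Function.Injective t := by
  classical
  intro v w h
  by_contra hne
  have h0 := ht (Finsupp.single v 1 + Finsupp.single w (-1)) (by
    rw [Finsupp.prod_add_index' (by simp) (by intros; exact zpow_add _ _ _),
      Finsupp.prod_single_index (by simp), Finsupp.prod_single_index (by simp)]
    simp [h])
  have := DFunLike.congr_fun h0 v
  simp [Ne.symm hne] at this

/-- The homomorphism from the free abelian group on `V` given by elements of a commutative group. -/
def liftTop (t : V → A) : RAAG (⊤ : SimpleGraph V) →* A :=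
  lift t fun _ _ _ => Commute.all _ _

@[simp]
theorem liftTop_gen (t : V → A) (v : V) : liftTop t (gen ⊤ v) = t v := lift_gen _ _ v

theorem exists_finsupp_prod (x : RAAG (⊤ : SimpleGraph V)) :
    ∃ z : V →₀ ℤ, (z.prod fun v n => gen ⊤ v ^ n) = x := by
  have : x ∈ Subgroup.closure (Set.range (gen (⊤ : SimpleGraph V))) := by
    rw [closure_range_gen]; trivial
  obtain ⟨z, hz⟩ := Subgroup.mem_closure_range_iff.1 this
  exact ⟨z, hz.symm⟩

/-- Squares enter twice: a scalar `a` has determinant `a ^ 2`, and a torus element has distinct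
eigenvalues `a`, `a⁻¹` only when `a ^ 2 ≠ 1`. -/
theorem MulIndep.eq_one_of_liftTop_sq (ht : MulIndep t) {x : RAAG (⊤ : SimpleGraph V)}
    (h : liftTop t x ^ 2 = 1) : x = 1 := by
  obtain ⟨z, rfl⟩ := exists_finsupp_prod x
  have : (2 : ℤ) • z = 0 := by
    apply ht
    rw [Finsupp.prod_of_support_subset _ (s := z.support) Finsupp.support_smul _ (by simp)]
    rw [map_finsuppProd, Finsupp.prod, ← Finset.prod_pow] at h
    rw [← h]
    refine Finset.prod_congr rfl fun v _ => ?_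
    rw [Finsupp.smul_apply, smul_eq_mul, zpow_mul', map_zpow, liftTop_gen, zpow_ofNat]
  have hz : z = 0 := by simpa using this
  simp [hz]

theorem MulIndep.liftTop_injective (ht : MulIndep t) : Function.Injective (liftTop t) := by
  rw [injective_iff_map_eq_one]
  intro x hx
  exact ht.eq_one_of_liftTop_sq (by simp [hx])

end MulIndep

/-- In every characteristic there is a field with as many independent elements as desired. -/
theorem exists_mulIndep (V : Type u) [Finite V] (p : ℕ) (hp : p = 0 ∨ p.Prime) :
    ∃ (K : Type w) (_ : Field K) (_ : CharP K p) (t : V → Kˣ), MulIndep t := by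
  obtain ⟨n, ⟨e⟩⟩ := Finite.exists_equiv_fin V
  have main : ∀ (k : Type) [Field k] [CharP k p],
      ∃ (K : Type w) (_ : Field K) (_ : CharP K p) (t : V → Kˣ), MulIndep t := by
    intro k _ _
    let σ := ULift.{w} (Fin n)
    let e' : V ≃ σ := e.trans Equiv.ulift.symm
    let R := MvPolynomial σ k
    let K := FractionRing R
    have hinj : Function.Injective (algebraMap R K) := IsFractionRing.injective R K
    have hX : ∀ s : σ, algebraMap R K (MvPolynomial.X s) ≠ 0 := fun s h =>
      MvPolynomial.X_ne_zero s (hinj (by rw [h, map_zero]))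
    let t : σ → Kˣ := fun s => Units.mk0 _ (hX s)
    have ht : MulIndep t := by
      intro z hz
      have hz1 : ∏ s, (t s) ^ z s = 1 := by
        rw [← hz, Finsupp.prod_fintype]; simp
      -- Moving negative exponents to the other side turns the relation into an equality of two
      -- monomials.
      have h1 : ∏ s, (t s) ^ (z s).toNat = ∏ s, (t s) ^ (-z s).toNat := by
        rw [← div_eq_one, ← Finset.prod_div_distrib, ← hz1]
        refine Finset.prod_congr rfl fun s _ => ?_
        rw [← zpow_natCast, ← zpow_natCast, div_eq_mul_inv, ← zpow_neg, ← zpow_add]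
        congr 1
        omega
      have h2 := congrArg (Units.val) h1
      simp only [Units.coe_prod, Units.val_pow_eq_pow_val, t, Units.val_mk0, ← map_pow,
        ← map_prod] at h2
      have h3 := hinj h2
      have h4 : ∀ f : σ → ℕ, ∏ s, (MvPolynomial.X s : R) ^ f s =
          MvPolynomial.monomial (Finsupp.equivFunOnFinite.symm f) 1 := by
        intro f
        rw [MvPolynomial.monomial_eq, Finsupp.prod_fintype _ _ (by simp)]
        simp
      rw [h4, h4] at h3
      have h5 := MvPolynomial.monomial_left_injective (one_ne_zero) h3
      ext s
      have h6 := DFunLike.congr_fun h5 s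
      simp at h6 ⊢
      omega
    refine ⟨K, inferInstance, charP_of_injective_algebraMap (algebraMap k K).injective p,
      t ∘ e', ht.comp e'.injective⟩
  rcases hp with rfl | hp
  · exact main ℚ
  · have := Fact.mk hp
    exact main (ZMod p)

open Polynomial Matrix

/-! ### Ping-pong for tori over `K[X]` -/

section PingPong
variable {K : Type*} [Field K]

/-- A projection of rank one of `K[X]²`, with kernel `(c, 1)` and image `(1 + c X, X)`. -/
noncomputable def proj (c : K) : Matrix (Fin 2) (Fin 2) K[X] :=
  !![1 + C c * X, -(C c * (1 + C c * X)); X, -(C c * X)]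

theorem proj_mul_proj (c : K) : proj c * proj c = proj c := by
  refine Matrix.ext fun i j => ?_
  fin_cases i <;> fin_cases j <;> simp [proj, Matrix.mul_apply, Fin.sum_univ_two] <;> ring

/-- The torus of the matrices with eigenvalues `a` on the image of `proj c` and `a⁻¹` on its
kernel. -/
noncomputable def torus (c : K) : Kˣ →* GL (Fin 2) K[X] :=
  MonoidHom.toHomUnits
    { toFun := fun a => C (a : K) • proj c + C (↑a⁻¹ : K) • (1 - proj c)
      map_one' := by simp
      map_mul' := fun a b => by
        simp only [add_mul, mul_add, Matrix.smul_mul, Matrix.mul_smul, sub_mul, mul_sub,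
          proj_mul_proj, one_mul, mul_one, sub_self, smul_zero, add_zero, zero_add, smul_smul,
          sub_zero, mul_inv, Units.val_mul, C_mul]
        rw [mul_comm (C (b : K)), mul_comm (C (↑b⁻¹ : K))] }

theorem torus_val (c : K) (a : Kˣ) : (torus c a).val =
    C (a : K) • proj c + C (↑a⁻¹ : K) • (1 - proj c) := rfl

theorem det_torus (c : K) (a : Kˣ) : (torus c a).val.det = 1 := by
  have h : (C (a : K) : K[X]) * C (↑a⁻¹ : K) = 1 := by rw [← C_mul]; simp
  rw [torus_val, Matrix.det_fin_two]
  simp [proj, -Units.val_inv_eq_inv_val]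
  linear_combination h

/-- The vectors `(s, y)` with `s / y` tending to `c` as `X` tends to infinity. -/
def nearSet (c : K) : Set (Fin 2 → K[X]) :=
  {v | v 1 ≠ 0 ∧ (v 0 - C c * v 1).degree < (v 1).degree}

theorem nearSet_nonempty (c : K) : (nearSet c).Nonempty :=
  ⟨![C c, 1], by simp [nearSet]⟩

theorem degree_of_mem_nearSet {c d : K} (h : c ≠ d) {v : Fin 2 → K[X]} (hv : v ∈ nearSet d) :
    (v 0 - C c * v 1).degree = (v 1).degree := by
  have e : v 0 - C c * v 1 = (v 0 - C d * v 1) + C (d - c) * v 1 := by rw [C_sub]; ring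
  have e2 : (C (d - c) * v 1).degree = (v 1).degree :=
    degree_C_mul (sub_ne_zero.2 h.symm)
  rw [e, degree_add_eq_right_of_degree_lt (by rw [e2]; exact hv.2), e2]

theorem nearSet_disjoint {c d : K} (h : c ≠ d) : Disjoint (nearSet c) (nearSet d) := by
  rw [Set.disjoint_left]
  intro v hc hd
  exact (degree_of_mem_nearSet h hd ▸ hc.2).false

/-- The form `f = v 0 - C c * v 1` has the degree of `v 1` and is only scaled by `a`, while the
second coordinate gains `(a - a⁻¹) f X`, so its degree rises by one. -/
theorem torus_mulVec_mem {c d : K} (h : c ≠ d) {a : Kˣ} (ha : a ^ 2 ≠ 1) {v : Fin 2 → K[X]}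
    (hv : v ∈ nearSet d) : (torus c a).val *ᵥ v ∈ nearSet c := by
  have hdeg := degree_of_mem_nearSet h hv
  set f := v 0 - C c * v 1 with hf
  have hbne : (a : K) - (↑a⁻¹ : K) ≠ 0 := by
    intro h0
    apply ha
    have : a = a⁻¹ := Units.ext (sub_eq_zero.1 h0)
    rw [pow_two]
    nth_rw 2 [this]
    simp
  have h1 : ((torus c a).val *ᵥ v) 1 =
      C (↑a⁻¹ : K) * v 1 + C ((a : K) - (↑a⁻¹ : K)) * (f * X) := by
    rw [torus_val]
    simp [proj, Matrix.mulVec, dotProduct, Fin.sum_univ_two, hf, C_sub]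
    ring
  have h0 : ((torus c a).val *ᵥ v) 0 - C c * ((torus c a).val *ᵥ v) 1 = C (a : K) * f := by
    rw [torus_val]
    simp [proj, Matrix.mulVec, dotProduct, Fin.sum_univ_two, hf]
    ring
  have hd : (C ((a : K) - (↑a⁻¹ : K)) * (f * X)).degree = (v 1).degree + 1 := by
    rw [degree_C_mul hbne, degree_mul_X, hdeg]
  have hlt : (v 1).degree < (v 1).degree + 1 := by
    rw [degree_eq_natDegree hv.1]
    exact_mod_cast Nat.lt_succ_self _
  have hd1 : (((torus c a).val *ᵥ v) 1).degree = (v 1).degree + 1 := by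
    rw [h1, degree_add_eq_right_of_degree_lt, hd]
    rw [hd, degree_C_mul (Units.ne_zero _)]
    exact hlt
  refine ⟨fun hz => ?_, ?_⟩
  · rw [hz, degree_zero, degree_eq_natDegree hv.1] at hd1
    exact absurd hd1 (by exact_mod_cast WithBot.bot_ne_coe)
  · rw [h0, hd1, degree_C_mul (Units.ne_zero _), hdeg]
    exact hlt

/-- Tori with distinct parameters generate their free product. -/
theorem torus_lift_injective {ι : Type*} [Nontrivial ι] {H : ι → Type*} [∀ i, Group (H i)]
    [∀ i, Infinite (H i)] {c : ι → K} (hc : Function.Injective c) (e : ∀ i, H i →* Kˣ)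
    (he : ∀ i x, e i x ^ 2 = 1 → x = 1) :
    Function.Injective (Monoid.CoprodI.lift fun i => (torus (c i)).comp (e i)) := by
  classical
  let : MulAction (GL (Fin 2) K[X]) (Fin 2 → K[X]) :=
    { smul := fun g v => g.val *ᵥ v
      one_smul := fun v => Matrix.one_mulVec v
      mul_smul := fun g h v => (Matrix.mulVec_mulVec v g.val h.val).symm }
  obtain ⟨i₀⟩ := (inferInstance : Nonempty ι)
  -- For two factors, ping-pong needs one of order at least 3; here all are infinite.
  refine Monoid.CoprodI.lift_injective_of_ping_pong _
    (Or.inr ⟨i₀, (Cardinal.natCast_le_aleph0 (n := 3)).trans (Cardinal.aleph0_le_mk _)⟩)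
    (fun i => nearSet (c i)) (fun i => nearSet_nonempty _)
    (fun i j hij => nearSet_disjoint (hc.ne hij)) ?_
  intro i j hij h hh
  rintro _ ⟨v, hv, rfl⟩
  exact torus_mulVec_mem (hc.ne hij) (fun h2 => hh (he i h h2)) hv

end PingPong

/-! ### The representation and its faithfulness -/

section Sufficiency
variable {V : Type*} (Γ : SimpleGraph V) {K : Type*} [Field K]

/-- The parameter of the torus that belongs to a component of `Γ'`. -/
noncomputable def param (t : V → Kˣ) (i : (deleteUniversal Γ).ConnectedComponent) : K :=
  t (Quot.out i).1

theorem param_injective {t : V → Kˣ} (ht : MulIndep t) : Function.Injective (param Γ t) := by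
  intro i j h
  have h1 := Subtype.ext (ht.injective (Units.ext h))
  rw [← Quot.out_eq i, ← Quot.out_eq j, h1]

open Classical in
/-- The image of a vertex: a scalar matrix for a universal vertex, else an element of the torus
that belongs to the component of the vertex. -/
noncomputable def vertexMatrix (t : V → Kˣ) (v : V) : GL (Fin 2) K[X] :=
  if h : v ∈ Γ.universalVertsᶜ then
    torus (param Γ t ((deleteUniversal Γ).connectedComponentMk ⟨v, h⟩)) (t v)
  else GeneralLinearGroup.scalar (Fin 2) (Units.map (C : K →+* K[X]).toMonoidHom (t v))

theorem vertexMatrix_of_universal (t : V → Kˣ) (v : Γ.universalVerts) :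
    vertexMatrix Γ t v =
      GeneralLinearGroup.scalar (Fin 2) (Units.map (C : K →+* K[X]).toMonoidHom (t v)) :=
  dif_neg (by simp)

theorem vertexMatrix_of_mem_supp (t : V → Kˣ) {i : (deleteUniversal Γ).ConnectedComponent}
    (v : i.supp) : vertexMatrix Γ t v.1.1 = torus (param Γ t i) (t v.1.1) := by
  obtain ⟨⟨v, hv⟩, rfl⟩ := v
  exact dif_pos hv

theorem vertexMatrix_commute (t : V → Kˣ) {v w : V} (hvw : Γ.Adj v w) :
    Commute (vertexMatrix Γ t v) (vertexMatrix Γ t w) := by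
  by_cases hv : v ∈ Γ.universalVerts
  · rw [vertexMatrix_of_universal Γ t ⟨v, hv⟩]
    exact GeneralLinearGroup.scalar_commute _ _
  by_cases hw : w ∈ Γ.universalVerts
  · rw [vertexMatrix_of_universal Γ t ⟨w, hw⟩]
    exact (GeneralLinearGroup.scalar_commute _ _).symm
  have e : (deleteUniversal Γ).connectedComponentMk ⟨w, hw⟩ =
      (deleteUniversal Γ).connectedComponentMk ⟨v, hv⟩ :=
    SimpleGraph.ConnectedComponent.sound
      (SimpleGraph.Adj.reachable (G := deleteUniversal Γ) (u := ⟨w, hw⟩) (v := ⟨v, hv⟩) hvw.symm)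
  rw [vertexMatrix_of_mem_supp Γ t (i := (deleteUniversal Γ).connectedComponentMk ⟨v, hv⟩)
      ⟨⟨v, hv⟩, rfl⟩,
    vertexMatrix_of_mem_supp Γ t (i := (deleteUniversal Γ).connectedComponentMk ⟨v, hv⟩)
      ⟨⟨w, hw⟩, e⟩]
  exact (Commute.all (t v) (t w)).map (torus _)

/-- The representation of `R(Γ)` by matrices over `K[X]`. -/
noncomputable def polyRep (t : V → Kˣ) : RAAG Γ →* GL (Fin 2) K[X] :=
  lift (vertexMatrix Γ t) fun _ _ h => vertexMatrix_commute Γ t h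

/-- The homomorphism onto the central subgroup generated by the universal vertices. -/
def universalHom : RAAG (⊤ : SimpleGraph Γ.universalVerts) →* RAAG Γ :=
  lift (fun v => gen Γ v) fun v _ h =>
    gen_commute (v.2 fun e => h (Subtype.ext e))

theorem universalHom_commute (z : RAAG (⊤ : SimpleGraph Γ.universalVerts)) (x : RAAG Γ) :
    Commute (universalHom Γ z) x := by
  refine commute_of_gen _ _ (fun v => ?_) z
  refine (commute_of_gen (MonoidHom.id _) _ (fun w => ?_) x).symm
  simp only [universalHom, lift_gen, MonoidHom.id_apply]
  by_cases h : (v : V) = w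
  · rw [h]
  · exact (gen_commute (v.2 h)).symm

variable {Γ}

/-- The homomorphism onto the subgroup generated by a complete component of `Γ'`. -/
def componentHom (hΓ : ∀ c : (deleteUniversal Γ).ConnectedComponent,
    (deleteUniversal Γ).IsClique c.supp) (i : (deleteUniversal Γ).ConnectedComponent) :
    RAAG (⊤ : SimpleGraph i.supp) →* RAAG Γ :=
  lift (fun v => gen Γ v.1.1) fun v w h =>
    gen_commute (hΓ i v.2 w.2 fun e => h (Subtype.ext e))

/-- The surjection onto `R(Γ)` from the product of the free abelian group on the universal vertices
and the free product of the free abelian groups on the components of `Γ'`. -/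
def decompHom (hΓ : ∀ c : (deleteUniversal Γ).ConnectedComponent,
    (deleteUniversal Γ).IsClique c.supp) :
    RAAG (⊤ : SimpleGraph Γ.universalVerts) × Monoid.CoprodI
      (fun i : (deleteUniversal Γ).ConnectedComponent => RAAG (⊤ : SimpleGraph i.supp)) →* RAAG Γ :=
  (universalHom Γ).noncommCoprod (Monoid.CoprodI.lift (componentHom hΓ))
    fun _ _ => universalHom_commute Γ _ _

variable (hΓ : ∀ c : (deleteUniversal Γ).ConnectedComponent, (deleteUniversal Γ).IsClique c.supp)

/-- Surjectivity suffices: faithfulness is tested on the source, so no normal form in `R(Γ)` is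
needed. -/
theorem decompHom_surjective : Function.Surjective (decompHom hΓ) := by
  rw [← MonoidHom.range_eq_top, eq_top_iff, ← closure_range_gen, Subgroup.closure_le]
  rintro _ ⟨v, rfl⟩
  by_cases hv : v ∈ Γ.universalVerts
  · exact ⟨(gen ⊤ ⟨v, hv⟩, 1), by simp [decompHom, universalHom]⟩
  · let i := (deleteUniversal Γ).connectedComponentMk ⟨v, hv⟩
    refine ⟨(1, Monoid.CoprodI.of (i := i) (gen ⊤ ⟨⟨v, hv⟩, rfl⟩)), ?_⟩
    simp [decompHom, componentHom]

theorem polyRep_universalHom (t : V → Kˣ) (z : RAAG (⊤ : SimpleGraph Γ.universalVerts)) :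
    polyRep Γ t (universalHom Γ z) = GeneralLinearGroup.scalar (Fin 2)
      (Units.map (C : K →+* K[X]).toMonoidHom (liftTop (fun v => t v.1) z)) := by
  have : (polyRep Γ t).comp (universalHom Γ) = (GeneralLinearGroup.scalar (Fin 2)).comp
      ((Units.map (C : K →+* K[X]).toMonoidHom).comp (liftTop (fun v => t v.1))) :=
    PresentedGroup.ext fun v => by
      simp only [MonoidHom.comp_apply, universalHom, lift_gen, liftTop_gen, polyRep]
      exact vertexMatrix_of_universal Γ t v
  exact DFunLike.congr_fun this z

theorem polyRep_comp_lift_componentHom (t : V → Kˣ) :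
    (polyRep Γ t).comp (Monoid.CoprodI.lift (componentHom hΓ)) =
      Monoid.CoprodI.lift fun i => (torus (param Γ t i)).comp (liftTop fun v => t v.1.1) := by
  refine Monoid.CoprodI.ext_hom _ _ fun i => PresentedGroup.ext fun v => ?_
  simp only [MonoidHom.comp_apply, Monoid.CoprodI.lift_of, componentHom, lift_gen, liftTop_gen,
    polyRep]
  exact vertexMatrix_of_mem_supp Γ t v

theorem det_polyRep_lift_componentHom (t : V → Kˣ) (g : Monoid.CoprodI
      (fun i : (deleteUniversal Γ).ConnectedComponent => RAAG (⊤ : SimpleGraph i.supp))) :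
    GeneralLinearGroup.det (polyRep Γ t (Monoid.CoprodI.lift (componentHom hΓ) g)) = 1 := by
  have : GeneralLinearGroup.det.comp
      ((polyRep Γ t).comp (Monoid.CoprodI.lift (componentHom hΓ))) = 1 := by
    rw [polyRep_comp_lift_componentHom]
    refine Monoid.CoprodI.ext_hom _ _ fun i => MonoidHom.ext fun x => Units.ext ?_
    simpa using det_torus _ _
  exact DFunLike.congr_fun this g

theorem polyRep_injective (hΓ : ∀ c : (deleteUniversal Γ).ConnectedComponent,
    (deleteUniversal Γ).IsClique c.supp) [Nontrivial (deleteUniversal Γ).ConnectedComponent] {t : V → Kˣ}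
    (ht : MulIndep t) : Function.Injective (polyRep Γ t) := by
  suffices h : Function.Injective ((polyRep Γ t).comp (decompHom hΓ)) by
    intro x y hxy
    obtain ⟨x, rfl⟩ := decompHom_surjective hΓ x
    obtain ⟨y, rfl⟩ := decompHom_surjective hΓ y
    rw [h hxy]
  have hcomp : ∀ i : (deleteUniversal Γ).ConnectedComponent,
      MulIndep (fun v : i.supp => t v.1.1) := fun i =>
    ht.comp (Subtype.val_injective.comp Subtype.val_injective)
  have hinf : ∀ i : (deleteUniversal Γ).ConnectedComponent,
      Infinite (RAAG (⊤ : SimpleGraph i.supp)) := fun i => by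
    obtain ⟨v, hv⟩ := i.nonempty_supp
    refine Infinite.of_injective (fun n : ℤ => gen ⊤ (⟨v, hv⟩ : i.supp) ^ n) fun m n hmn => ?_
    have h1 := congrArg (liftTop fun v : i.supp => t v.1.1) hmn
    simp only [map_zpow, liftTop_gen] at h1
    have h2 := (hcomp i).pow_eq_one (v := ⟨v, hv⟩) (n := m - n) (by
      simp only [_root_.zpow_sub, h1, mul_inv_cancel])
    omega
  have hfree := torus_lift_injective (param_injective Γ ht)
    (fun i => liftTop fun v : i.supp => t v.1.1) fun i x hx => (hcomp i).eq_one_of_liftTop_sq hx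
  rw [← polyRep_comp_lift_componentHom hΓ] at hfree
  rw [injective_iff_map_eq_one]
  rintro ⟨z, g⟩ hzg
  rw [MonoidHom.comp_apply, decompHom, MonoidHom.noncommCoprod_apply, map_mul] at hzg
  -- The determinant ignores the free product and leaves the square of the scalar.
  have hz : z = 1 := by
    have h1 := congrArg GeneralLinearGroup.det hzg
    rw [map_mul, det_polyRep_lift_componentHom, polyRep_universalHom, GeneralLinearGroup.det_scalar,
      mul_one, map_one, Fintype.card_fin, ← map_pow] at h1
    have h2 := Units.map_injective (f := (C : K →+* K[X]).toMonoidHom) C_injective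
      (h1.trans (map_one _).symm)
    exact (ht.comp Subtype.val_injective).eq_one_of_liftTop_sq h2
  subst hz
  rw [map_one, map_one, one_mul] at hzg
  rw [Prod.mk_eq_one]
  exact ⟨rfl, (injective_iff_map_eq_one _).1 hfree g hzg⟩

end Sufficiency

theorem hasFaithfulRep_two {V : Type u} [Finite V] {Γ : SimpleGraph V}
    (hΓ : TwoOrMoreCompleteComponents (deleteUniversal Γ)) (p : ℕ) (hp : p = 0 ∨ p.Prime) :
    ∃ (F : Type w) (_ : Field F) (_ : CharP F p), HasFaithfulRep (RAAG Γ) F 2 := by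
  obtain ⟨K, _, _, t, ht⟩ := exists_mulIndep.{w, u} V p hp
  have : Nontrivial (deleteUniversal Γ).ConnectedComponent := by
    rw [← ENat.one_lt_card_iff_nontrivial]
    exact lt_of_lt_of_le (by norm_num) hΓ.1
  refine ⟨FractionRing K[X], inferInstance,
    charP_of_injective_algebraMap (algebraMap K (FractionRing K[X])).injective p,
    (GeneralLinearGroup.map (algebraMap K[X] (FractionRing K[X]))).comp (polyRep Γ t), ?_⟩
  rw [MonoidHom.coe_comp]
  refine Function.Injective.comp (Units.map_injective ?_) (polyRep_injective hΓ.2 ht)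
  exact Matrix.map_injective (IsFractionRing.injective K[X] (FractionRing K[X]))

theorem hasFaithfulRep_one_of_top (V : Type u) [Finite V] (p : ℕ) (hp : p = 0 ∨ p.Prime) :
    ∃ (F : Type w) (_ : Field F) (_ : CharP F p),
      HasFaithfulRep (RAAG (⊤ : SimpleGraph V)) F 1 := by
  obtain ⟨K, _, _, t, ht⟩ := exists_mulIndep.{w, u} V p hp
  refine ⟨K, inferInstance, inferInstance,
    (GeneralLinearGroup.scalar (Fin 1)).comp (liftTop t), ?_⟩
  rw [MonoidHom.coe_comp]
  refine Function.Injective.comp (fun a b h => ?_) ht.liftTop_injective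
  have := congrArg GeneralLinearGroup.det h
  simpa using this

/-! ### Necessity: commutation in dimensions one and two -/

theorem commute_of_hasFaithfulRep_one {G : Type*} [Group G] {F : Type*} [Field F]
    (h : HasFaithfulRep G F 1) (x y : G) : Commute x y := by
  obtain ⟨ρ, hρ⟩ := h
  apply hρ
  rw [map_mul, map_mul]
  ext i j
  simp [Matrix.mul_apply, Subsingleton.elim i 0, Subsingleton.elim j 0, mul_comm]

/-- Two vectors that are parallel to a third one, nonzero, are parallel. -/
theorem parallel_of_parallel {F : Type*} [Field F] {u₁ u₂ u₃ v₁ v₂ v₃ w₁ w₂ w₃ : F} (hw : w₁ ≠ 0)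
    (hu₂ : u₁ * w₂ = u₂ * w₁) (hu₃ : u₁ * w₃ = u₃ * w₁)
    (hv₂ : v₁ * w₂ = v₂ * w₁) (hv₃ : v₁ * w₃ = v₃ * w₁) :
    u₁ * v₂ = u₂ * v₁ ∧ u₁ * v₃ = u₃ * v₁ ∧ u₂ * v₃ = u₃ * v₂ := by
  obtain rfl := (eq_div_iff hw).2 hu₂.symm
  obtain rfl := (eq_div_iff hw).2 hu₃.symm
  obtain rfl := (eq_div_iff hw).2 hv₂.symm
  obtain rfl := (eq_div_iff hw).2 hv₃.symm
  refine ⟨?_, ?_, ?_⟩ <;> ring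

/-- In dimension two, an element that commutes with two noncommuting ones is central. -/
theorem commute_of_hasFaithfulRep_two {G : Type*} [Group G] {F : Type*} [Field F]
    (h : HasFaithfulRep G F 2) {a b c : G} (hab : Commute a b) (hcb : Commute c b)
    (hac : ¬ Commute a c) (d : G) : Commute b d := by
  obtain ⟨ρ, hρ⟩ := h
  have key : ∀ x y : G, Commute x y ↔ (ρ x).val * (ρ y).val = (ρ y).val * (ρ x).val := fun x y => by
    rw [← Units.val_mul, ← Units.val_mul, Units.val_inj, ← map_mul, ← map_mul, hρ.eq_iff]
    rfl
  rw [key] at *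
  simp only [← Matrix.ext_iff, Fin.forall_fin_two, Matrix.mul_apply, Fin.sum_univ_two] at *
  generalize (ρ a).val = A at *
  generalize (ρ b).val = B at *
  generalize (ρ c).val = C at *
  generalize (ρ d).val = D at *
  obtain ⟨⟨h1, h2⟩, h3, -⟩ := hab
  obtain ⟨⟨k1, k2⟩, k3, -⟩ := hcb
  -- Two matrices commute iff their vectors (two off-diagonal entries, difference of diagonal
  -- entries) are parallel. If the vector of `B` were nonzero, those of `A` and `C` would be
  -- parallel; so `B` is scalar.
  have goal_of : A 0 1 * C 1 0 = A 1 0 * C 0 1 → (A 0 0 - A 1 1) * C 0 1 = A 0 1 * (C 0 0 - C 1 1) →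
      (A 0 0 - A 1 1) * C 1 0 = A 1 0 * (C 0 0 - C 1 1) → False := fun g1 g2 g3 =>
    hac ⟨⟨by linear_combination g1, by linear_combination g2⟩,
      by linear_combination -g3, by linear_combination -g1⟩
  have e1 : B 0 1 = 0 := by
    by_contra hne
    obtain ⟨g1, g2, g3⟩ := parallel_of_parallel (u₁ := A 0 1) (u₂ := A 1 0) (u₃ := A 0 0 - A 1 1)
      (v₁ := C 0 1) (v₂ := C 1 0) (v₃ := C 0 0 - C 1 1) (w₂ := B 1 0) (w₃ := B 0 0 - B 1 1) hne
      (by linear_combination h1) (by linear_combination -h2)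
      (by linear_combination k1) (by linear_combination -k2)
    exact goal_of g1 g2.symm g3.symm
  have e2 : B 1 0 = 0 := by
    by_contra hne
    obtain ⟨g1, g2, g3⟩ := parallel_of_parallel (u₁ := A 1 0) (u₂ := A 0 1) (u₃ := A 0 0 - A 1 1)
      (v₁ := C 1 0) (v₂ := C 0 1) (v₃ := C 0 0 - C 1 1) (w₂ := B 0 1) (w₃ := B 0 0 - B 1 1) hne
      (by linear_combination -h1) (by linear_combination h3)
      (by linear_combination -k1) (by linear_combination k3)
    exact goal_of g1.symm g3.symm g2.symm
  have e3 : B 0 0 = B 1 1 := by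
    by_contra hne
    obtain ⟨g1, g2, g3⟩ := parallel_of_parallel (u₁ := A 0 0 - A 1 1) (u₂ := A 0 1) (u₃ := A 1 0)
      (v₁ := C 0 0 - C 1 1) (v₂ := C 0 1) (v₃ := C 1 0) (w₂ := B 0 1) (w₃ := B 1 0)
      (sub_ne_zero.2 hne)
      (by linear_combination h2) (by linear_combination -h3)
      (by linear_combination k2) (by linear_combination -k3)
    exact goal_of g3 g1 g2
  rw [e1, e2, e3]
  refine ⟨⟨?_, ?_⟩, ?_, ?_⟩ <;> ring

/-- The necessity of the condition on `Γ'`. -/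
theorem twoOrMoreCompleteComponents {V : Type*} {Γ : SimpleGraph V} (hne : Γ ≠ ⊤) {F : Type*}
    [Field F] (h : HasFaithfulRep (RAAG Γ) F 2) :
    TwoOrMoreCompleteComponents (deleteUniversal Γ) := by
  have path : ∀ a b c : ↥(Γ.universalVertsᶜ), Γ.Adj a b → Γ.Adj b c → a ≠ c → Γ.Adj a c := by
    rintro ⟨a, ha⟩ ⟨b, hb⟩ ⟨c, hc⟩ hab hbc hac
    by_contra hn
    obtain ⟨d, hbd, hd⟩ : ∃ d, b ≠ d ∧ ¬ Γ.Adj b d := by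
      by_contra! hall
      exact hb fun d hd => hall d hd
    exact not_commute_gen hbd hd (commute_of_hasFaithfulRep_two h (gen_commute hab)
      (gen_commute hbc).symm (not_commute_gen (fun e => hac (Subtype.ext e)) hn) _)
  have walk : ∀ a b : ↥(Γ.universalVertsᶜ), (deleteUniversal Γ).Reachable a b → a ≠ b →
      Γ.Adj a b := by
    rintro a b ⟨w⟩
    induction w with
    | nil => exact fun h => absurd rfl h
    | @cons u v x huv w ih =>
      intro hux
      by_cases hvx : v = x
      · exact hvx ▸ huv
      · exact path u v x huv (ih hvx) hux
  refine ⟨?_, fun i a ha b hb hab =>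
    walk a b (SimpleGraph.ConnectedComponent.exact (ha.trans hb.symm)) hab⟩
  -- Distinct nonadjacent vertices are not universal, and by `walk` they lie in different
  -- components.
  obtain ⟨a, b, hab, hn⟩ := SimpleGraph.ne_top_iff_exists_not_adj.1 hne
  have ha : a ∈ Γ.universalVertsᶜ := fun h => hn (h hab)
  have hb : b ∈ Γ.universalVertsᶜ := fun h => hn (h hab.symm).symm
  have hnt : Nontrivial (deleteUniversal Γ).ConnectedComponent :=
    ⟨(deleteUniversal Γ).connectedComponentMk ⟨a, ha⟩,
      (deleteUniversal Γ).connectedComponentMk ⟨b, hb⟩, fun e =>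
        hn (walk _ _ (SimpleGraph.ConnectedComponent.exact e) fun h => hab (congrArg Subtype.val h))⟩
  have := (ENat.one_lt_card_iff_nontrivial _).2 hnt
  exact Order.add_one_le_of_lt this

theorem not_hasFaithfulRep_one {V : Type*} {Γ : SimpleGraph V}
    (hΓ : TwoOrMoreCompleteComponents (deleteUniversal Γ)) {F : Type*} [Field F] :
    ¬ HasFaithfulRep (RAAG Γ) F 1 := by
  intro h
  have : Nontrivial (deleteUniversal Γ).ConnectedComponent := by
    rw [← ENat.one_lt_card_iff_nontrivial]
    exact lt_of_lt_of_le (by norm_num) hΓ.1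
  obtain ⟨i, -⟩ := exists_pair_ne (deleteUniversal Γ).ConnectedComponent
  obtain ⟨⟨v, hv⟩, -⟩ := i.nonempty_supp
  exact hv fun w hvw => by
    by_contra hn
    exact not_commute_gen hvw hn (commute_of_hasFaithfulRep_one h _ _)

/-! ### Minimal dimensions -/

theorem sInf_dim_eq_two_iff (P : ℕ → Prop) :
    sInf {x : ℕ∞ | ∃ d : ℕ, x = (d : ℕ∞) ∧ 1 ≤ d ∧ P d} = 2 ↔ P 2 ∧ ¬ P 1 := by
  constructor
  · intro h
    have hmem : (2 : ℕ∞) ∈ {x : ℕ∞ | ∃ d : ℕ, x = (d : ℕ∞) ∧ 1 ≤ d ∧ P d} := by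
      nth_rw 1 [← h]
      -- The infimum of the empty set is `⊤`, not 2, so the value 2 is attained.
      refine csInf_mem (Set.nonempty_iff_ne_empty.2 fun he => ?_)
      rw [he, sInf_empty] at h
      exact absurd h (by decide)
    obtain ⟨d, hd, -, hP⟩ := hmem
    obtain rfl : d = 2 := by exact_mod_cast hd.symm
    refine ⟨hP, fun h1 => ?_⟩
    have h2 : sInf {x : ℕ∞ | ∃ d : ℕ, x = (d : ℕ∞) ∧ 1 ≤ d ∧ P d} ≤ ((1 : ℕ) : ℕ∞) :=
      sInf_le ⟨1, rfl, le_rfl, h1⟩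
    rw [h] at h2
    exact absurd h2 (by norm_num)
  · rintro ⟨h2, h1⟩
    refine le_antisymm (sInf_le ⟨2, rfl, by norm_num, h2⟩) (le_sInf ?_)
    rintro _ ⟨d, rfl, hd, hP⟩
    have : d ≠ 1 := by rintro rfl; exact h1 hP
    exact_mod_cast (show 2 ≤ d by omega)

theorem minDim_eq_two_iff {V : Type u} [Finite V] (Γ : SimpleGraph V) :
    minDim.{w} (RAAG Γ) = 2 ↔ TwoOrMoreCompleteComponents (deleteUniversal Γ) := by
  rw [minDim, sInf_dim_eq_two_iff
    (fun d => ∃ (F : Type w) (_ : Field F), HasFaithfulRep (RAAG Γ) F d)]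
  constructor
  · rintro ⟨⟨F, _, h2⟩, h1⟩
    refine twoOrMoreCompleteComponents ?_ h2
    rintro rfl
    obtain ⟨K, hK, -, h⟩ := hasFaithfulRep_one_of_top.{w, u} V 0 (Or.inl rfl)
    exact h1 ⟨K, hK, h⟩
  · intro hΓ
    obtain ⟨K, hK, -, h⟩ := hasFaithfulRep_two.{w, u} hΓ 0 (Or.inl rfl)
    exact ⟨⟨K, hK, h⟩, fun ⟨F, _, h1⟩ => not_hasFaithfulRep_one hΓ h1⟩

theorem minDimChar_eq_two_iff {V : Type u} [Finite V] (Γ : SimpleGraph V) (p : ℕ)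
    (hp : p = 0 ∨ p.Prime) :
    minDimChar.{w} p (RAAG Γ) = 2 ↔ TwoOrMoreCompleteComponents (deleteUniversal Γ) := by
  rw [minDimChar, sInf_dim_eq_two_iff
    (fun d => ∃ (F : Type w) (_ : Field F) (_ : CharP F p), HasFaithfulRep (RAAG Γ) F d)]
  constructor
  · rintro ⟨⟨F, _, _, h2⟩, h1⟩
    refine twoOrMoreCompleteComponents ?_ h2
    rintro rfl
    exact h1 (hasFaithfulRep_one_of_top V p hp)
  · intro hΓ
    exact ⟨hasFaithfulRep_two hΓ p hp, fun ⟨F, _, _, h1⟩ => not_hasFaithfulRep_one hΓ h1⟩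

end RAAG

theorem mainTheorem8 {V : Type u} [Finite V] (Γ : SimpleGraph V) :
    (minDim.{w} (RAAG Γ) = 2 ↔ TwoOrMoreCompleteComponents (deleteUniversal Γ)) ∧
    ((∀ p : ℕ, p = 0 ∨ p.Prime → minDimChar.{w} p (RAAG Γ) = 2) ↔
      TwoOrMoreCompleteComponents (deleteUniversal Γ)) ∧
    (∀ p : ℕ, p = 0 ∨ p.Prime →
      (minDimChar.{w} p (RAAG Γ) = 2 ↔ TwoOrMoreCompleteComponents (deleteUniversal Γ))) :=
  ⟨RAAG.minDim_eq_two_iff Γ,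
    ⟨fun h => (RAAG.minDimChar_eq_two_iff Γ 0 (Or.inl rfl)).1 (h 0 (Or.inl rfl)),
      fun h p hp => (RAAG.minDimChar_eq_two_iff Γ p hp).2 h⟩,
    RAAG.minDimChar_eq_two_iff Γ⟩
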